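/- Let $n\in\mathbb N$ and let $p,q>0$ be reals with $p+q\le 1$. **The informed game (no connection costs).** A network is a simple undirected graph $E$ on $[n]$; $N_i(E)$ denotes the set of neighbours of $i$. Each individual $i$ independently receives $X_i$ exogenous opportunities, where $X_i=0$ with probability $q$, $X_i=2$ with probability $p$, and $X_i=1$ with probability $1-p-q$. Given $(X_i)_{i\in[n]}$, each individual $j$ with $X_j=2$ that has at least one neighbour $i$ with $X_i=0$ passes one opportunity to a uniformly random such neighbour, independently over $j$; nothing else is passed. Let $R_{ji}\in\{0,1\}$ indicate that $j$ passes an opportunity to $i$. The expected utility of $i$ is $$u_i(E)=\mathbb E\Big[\min\Big\{1,\;X_i+\sum_{j\in N_i(E)}R_{ji}\Big\}\Big].$$ A network is *efficient* if it maximizes $\sum_{i\in[n]}u_i(E)$ over all networks on $[n]$. A network $E$ is an *equilibrium* (defection-free pairwise Nash) if 1. for all $i\ne j$ with $ij\notin E$ and all $S_i\subseteq N_i(E)$, $S_j\subseteq N_j(E)$, we have $u_i\big((E\cup\{ij\})\setminus\{i\ell:\ell\in S_i\}\big)\le u_i(E)$ or $u_j\big((E\cup\{ij\})\setminus\{j\ell:\ell\in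 S_j\}\big)\le u_j(E)$; and 2. for every $ij\in E$, $u_i(E\setminus\{ij\})\le u_i(E)$ and $u_j(E\setminus\{ij\})\le u_j(E)$. Let $D$ be the set of maximizers, over integers $0\le d\le n$, of $$f(d)=1-q\left(1-\frac pq\cdot\frac{1-(1-q)^d}{d}\right)^d,\qquad f(0)=1-q.$$ **Proposition.** (a) If $d\in D$, then every $d$-regular network on $[n]$ without cycles of length 3 or 4 is efficient. (b) The complete network is the unique equilibrium. (c) If for some $d\in D$ there is a $d$-regular network on $[n]$ without cycles of length 3 or 4 (that is, if (a) applies to some network on $[n]$), then every efficient network $E$ strictly Pareto-improves on every equilibrium network $E'$: $u_i(E)>u_i(E')$ for every $i\in[n]$. -/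

import Mathlib

noncomputable section

namespace InformedGame

open scoped Classical in
/-- The set of neighbours (social contacts) of individual `i` in the network `E`. -/
def nbrs {n : ℕ} (E : SimpleGraph (Fin n)) (i : Fin n) : Finset (Fin n) :=
  Finset.univ.filter (fun j => E.Adj i j)

/-- The law of the number of exogenous opportunities of one individual:
`0` with probability `q`, `2` with probability `p`, and `1` with probability `1 - p - q`. -/
def opportunityProb (q p : ℝ) (k : Fin 3) : ℝ :=
  if k = 0 then q else if k = 2 then p else 1 - p - q

/-- The neighbours of `j` that received no exogenous opportunity. -/
def needy {n : ℕ} (E : SimpleGraph (Fin n)) (x : Fin n → Fin 3) (j : Fin n) : Finset (Fin n) :=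
  (nbrs E j).filter (fun i => x i = 0)

/-- Conditionally on the exogenous opportunities `x`, the probability that the recipient of the
opportunity passed on by `j` is `t`, where `none` means that `j` passes nothing.  An individual
passes an opportunity if and only if it has two of them and at least one neighbour without any,
and then to a uniformly random such neighbour. -/
def passProb {n : ℕ} (E : SimpleGraph (Fin n)) (x : Fin n → Fin 3) (j : Fin n) :
    Option (Fin n) → ℝ
  | none => if x j = 2 ∧ (needy E x j).Nonempty then 0 else 1
  | some i => if x j = 2 ∧ i ∈ needy E x j then 1 / ((needy E x j).card : ℝ) else 0

/-- The probability of the outcome with exogenous opportunities `x` and recipients `t`: the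
numbers `x i` are independent, and given `x` the individuals choose recipients independently. -/
def outcomeProb {n : ℕ} (E : SimpleGraph (Fin n)) (q p : ℝ) (x : Fin n → Fin 3)
    (t : Fin n → Option (Fin n)) : ℝ :=
  (∏ i, opportunityProb q p (x i)) * ∏ j, passProb E x j (t j)

/-- The realized utility of `i`: opportunities used (at most one) minus connection costs. -/
def payoff {n : ℕ} (E : SimpleGraph (Fin n)) (γ : ℝ) (x : Fin n → Fin 3)
    (t : Fin n → Option (Fin n)) (i : Fin n) : ℝ :=
  min 1 (((x i : ℕ) : ℝ) + ∑ j ∈ nbrs E i, if t j = some i then (1 : ℝ) else 0)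
    - γ * ((nbrs E i).card : ℝ)

/-- The expected utility of `i` in the informed game. -/
def utility {n : ℕ} (E : SimpleGraph (Fin n)) (q p γ : ℝ) (i : Fin n) : ℝ :=
  ∑ x : Fin n → Fin 3, ∑ t : Fin n → Option (Fin n), outcomeProb E q p x t * payoff E γ x t i

/-- Social welfare: the sum of all expected utilities. -/
def welfare {n : ℕ} (E : SimpleGraph (Fin n)) (q p γ : ℝ) : ℝ :=
  ∑ i, utility E q p γ i

/-- A network is efficient if it maximizes social welfare among all networks on `[n]`. -/
def IsEfficient {n : ℕ} (E : SimpleGraph (Fin n)) (q p γ : ℝ) : Prop :=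
  ∀ E' : SimpleGraph (Fin n), welfare E' q p γ ≤ welfare E q p γ

/-- The network obtained from `E` by forming the edge `ij` and dropping the edges from `i` to the
members of `S`. -/
def addAndDrop {n : ℕ} (E : SimpleGraph (Fin n)) (i j : Fin n) (S : Finset (Fin n)) :
    SimpleGraph (Fin n) :=
  (E ⊔ SimpleGraph.fromEdgeSet {s(i, j)}).deleteEdges {e | ∃ l ∈ S, e = s(i, l)}

/-- Defection-free pairwise Nash equilibrium of the informed game. -/
def IsEquilibrium {n : ℕ} (E : SimpleGraph (Fin n)) (q p γ : ℝ) : Prop :=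
  (∀ i j : Fin n, i ≠ j → ¬ E.Adj i j → ∀ Si ⊆ nbrs E i, ∀ Sj ⊆ nbrs E j,
    utility (addAndDrop E i j Si) q p γ i - utility E q p γ i ≤ 0 ∨
    utility (addAndDrop E j i Sj) q p γ j - utility E q p γ j ≤ 0) ∧
  (∀ i j : Fin n, E.Adj i j →
    utility (E.deleteEdges {s(i, j)}) q p γ i - utility E q p γ i ≤ 0 ∧
    utility (E.deleteEdges {s(i, j)}) q p γ j - utility E q p γ j ≤ 0)

/-- `E` is a `d`-regular network without cycles of length 3 or 4. -/
def IsCycleFreeRegular {n : ℕ} (E : SimpleGraph (Fin n)) (d : ℕ) : Prop :=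
  (∀ i, (nbrs E i).card = d) ∧
  ∀ (v : Fin n) (c : E.Walk v v), c.IsCycle → c.length ≠ 3 ∧ c.length ≠ 4

/-- The objective `1 - q (1 - (p / q) (1 - (1 - q) ^ d) / d) ^ d`, with value `1 - q` at `d = 0`. -/
def objective (q p : ℝ) (d : ℕ) : ℝ :=
  1 - q * (1 - p / q * ((1 - (1 - q) ^ d) / (d : ℝ))) ^ d

/-- `d` maximizes the objective over the natural numbers `0 ≤ d ≤ n`. -/
def IsOptimalDegree (n : ℕ) (q p : ℝ) (d : ℕ) : Prop :=
  d ∈ Set.Iic n ∧ IsMaxOn (objective q p) (Set.Iic n) d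

end InformedGame

end

/-!
A needy individual `i` misses out if none of its neighbours passes it an opportunity, and
`utility_eq` gives `u_i = 1 - q * missProb i`, where `missProb i` is the expectation of a product
over the neighbours `j` of `i`. The factor of `j` depends on the exogenous opportunities of `j` and
of the competitors of `i` at `j`, and is decreasing in all of them. By symmetry between `i` and its
competitors, the factor of `j` has expectation `1 - g (deg j)`, where
`g d = (p / q) (1 - (1 - q) ^ d) / d` (`hitProb`, `expect_passTo`).

Harris' inequality (an instance of `fkg`) yields `missProb i ≥ ∏ j ∈ N_i, (1 - g (deg j))`
(`prod_le_missProb`). Without cycles of length 3 or 4 the factors depend on disjoint sets of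
coordinates, and equality holds (`missProb_eq_of_cycleFree`). The product of these lower bounds over
all `i` is `∏ j, (1 - g (deg j)) ^ deg j`, since `j` contributes to each of its `deg j` neighbours;
so by the inequality of arithmetic and geometric means their sum is at least
`n * min_d (1 - g d) ^ d` (`sum_prod_nbrs`). A `d`-regular network with `d` optimal and without short
cycles attains this bound, hence is efficient.

A new link leaves the competitors at the old neighbours of its ends unchanged, so it strictly
benefits both ends (`utility_lt_of_add_edge`), and the complete network is the only equilibrium.

If the bound is attained, the equality case of the arithmetic-geometric mean inequality forces
`missProb i = min_d (1 - g d) ^ d` for every `i` in every efficient network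
(`missProb_eq_of_isEfficient`). In the complete network `missProb i` is strictly larger: for `n ≥ 3`
there are triangles, which make the correlation of the factors strict
(`prod_lt_missProb_of_triangle`), and for `n ≤ 2` no degree below `n` is optimal.
-/

namespace InformedGame

open Finset

variable {n : ℕ}

/-! ### Expectations over the exogenous opportunities -/

/-- The probability of the vector `x` of exogenous opportunities. -/
noncomputable def law (q p : ℝ) (x : Fin n → Fin 3) : ℝ := ∏ i, opportunityProb q p (x i)

/-- The expectation of a function of the exogenous opportunities. -/
noncomputable def expect (q p : ℝ) (F : (Fin n → Fin 3) → ℝ) : ℝ := ∑ x, law q p x * F x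

lemma opportunityProb_nonneg {q p : ℝ} (hq : 0 < q) (hp : 0 < p) (hqp : q + p ≤ 1) (k : Fin 3) :
    0 ≤ opportunityProb q p k := by
  unfold opportunityProb
  split_ifs <;> linarith

lemma sum_opportunityProb (q p : ℝ) : ∑ k, opportunityProb q p k = 1 := by
  simp [Fin.sum_univ_three, opportunityProb]

lemma law_nonneg {q p : ℝ} (hq : 0 < q) (hp : 0 < p) (hqp : q + p ≤ 1) (x : Fin n → Fin 3) :
    0 ≤ law q p x :=
  prod_nonneg fun i _ => opportunityProb_nonneg hq hp hqp (x i)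

/-- The value `1` has to be avoided, as its probability `1 - p - q` may vanish. -/
lemma law_pos {q p : ℝ} (hq : 0 < q) (hp : 0 < p) {x : Fin n → Fin 3} (hx : ∀ i, x i ≠ 1) :
    0 < law q p x := by
  refine prod_pos fun i _ => ?_
  have := hx i
  unfold opportunityProb
  split_ifs with h0 h2
  · exact hq
  · exact hp
  · omega

/-- The expectation of a product of functions of single coordinates factorizes. -/
lemma expect_prod_coord (q p : ℝ) (h : Fin n → Fin 3 → ℝ) :
    expect q p (fun x => ∏ i, h i (x i)) = ∏ i, ∑ k, opportunityProb q p k * h i k := by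
  rw [Fintype.prod_sum]
  simp only [expect, law, prod_mul_distrib]

lemma expect_one (q p : ℝ) : expect q p (fun _ : Fin n → Fin 3 => 1) = 1 := by
  have := expect_prod_coord (n := n) q p (fun _ _ => 1)
  simpa [sum_opportunityProb] using this

lemma expect_coord (q p : ℝ) (i : Fin n) (h : Fin 3 → ℝ) :
    expect q p (fun x => h (x i)) = ∑ k, opportunityProb q p k * h k := by
  have := expect_prod_coord q p (fun j k => if j = i then h k else 1)
  simp only [prod_ite_eq', mem_univ, if_true] at this
  rw [this, prod_eq_single i]
  · simp
  · intro j _ hj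
    simp [hj, sum_opportunityProb]
  · simp

lemma expect_sub (q p : ℝ) (F G : (Fin n → Fin 3) → ℝ) :
    expect q p (fun x => F x - G x) = expect q p F - expect q p G := by
  simp [expect, mul_sub]

lemma expect_sum {ι : Type*} (q p : ℝ) (s : Finset ι) (F : ι → (Fin n → Fin 3) → ℝ) :
    expect q p (fun x => ∑ i ∈ s, F i x) = ∑ i ∈ s, expect q p (F i) := by
  simp only [expect, mul_sum]
  exact sum_comm

lemma expect_lt {q p : ℝ} (hq : 0 < q) (hp : 0 < p) (hqp : q + p ≤ 1)
    {F G : (Fin n → Fin 3) → ℝ} (h : ∀ x, F x ≤ G x) (y : Fin n → Fin 3) (hy : ∀ i, y i ≠ 1)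
    (hlt : F y < G y) : expect q p F < expect q p G :=
  sum_lt_sum (fun x _ => mul_le_mul_of_nonneg_left (h x) (law_nonneg hq hp hqp x))
    ⟨y, mem_univ y, mul_lt_mul_of_pos_left hlt (law_pos hq hp hy)⟩

lemma expect_comp_perm (q p : ℝ) (σ : Equiv.Perm (Fin n)) (F : (Fin n → Fin 3) → ℝ) :
    expect q p (fun x => F (x ∘ σ)) = expect q p F := by
  refine Fintype.sum_equiv (Equiv.arrowCongr σ.symm (Equiv.refl _)) _ _ fun x => ?_
  have : law q p (x ∘ σ) = law q p x := by
    simp only [law, Function.comp]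
    exact Equiv.prod_comp σ (fun i => opportunityProb q p (x i))
  change law q p x * F (x ∘ σ) = law q p (x ∘ σ) * F (x ∘ σ)
  rw [this]

/-- Functions of disjoint sets of coordinates are uncorrelated.  Exchanging the coordinates outside
`A` between two independent copies of `x` preserves their joint law and turns `F x * G y` into
`F x * G x`. -/
lemma expect_mul_of_dependsOn (q p : ℝ) (A : Finset (Fin n)) {F G : (Fin n → Fin 3) → ℝ}
    (hF : DependsOn F (A : Set (Fin n))) (hG : DependsOn G (A : Set (Fin n))ᶜ) :
    expect q p (fun x => F x * G x) = expect q p F * expect q p G := by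
  let e : (Fin n → Fin 3) × (Fin n → Fin 3) → (Fin n → Fin 3) × (Fin n → Fin 3) :=
    fun z => (A.piecewise z.1 z.2, A.piecewise z.2 z.1)
  have he : Function.Involutive e := by
    rintro ⟨x, y⟩
    ext i <;> by_cases hi : i ∈ A <;> simp [e, hi]
  have h1 : expect q p F * expect q p G =
      ∑ z : (Fin n → Fin 3) × (Fin n → Fin 3), law q p z.1 * F z.1 * (law q p z.2 * G z.2) := by
    rw [Fintype.sum_prod_type, expect, expect, sum_mul_sum]
  have h2 : expect q p (fun x => F x * G x) = ∑ z : (Fin n → Fin 3) × (Fin n → Fin 3),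
      law q p z.1 * (F z.1 * G z.1) * law q p z.2 := by
    rw [Fintype.sum_prod_type]
    simp only [← mul_sum]
    have : ∑ y : Fin n → Fin 3, law q p y = 1 := by simpa [expect] using expect_one (n := n) q p
    simp [this, expect]
  rw [h1, h2]
  refine Fintype.sum_equiv he.toPerm _ _ ?_
  rintro ⟨x, y⟩
  change _ = law q p (A.piecewise x y) * F (A.piecewise x y) *
    (law q p (A.piecewise y x) * G (A.piecewise y x))
  have hFx : F (A.piecewise x y) = F x := hF fun i hi => by simp [mem_coe.1 hi]
  have hGx : G (A.piecewise y x) = G x := hG fun i hi => by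
    have : i ∉ A := fun h => hi (mem_coe.2 h)
    simp [this]
  have hl : law q p (A.piecewise x y) * law q p (A.piecewise y x) = law q p x * law q p y := by
    simp only [law, ← prod_mul_distrib]
    refine prod_congr rfl fun i _ => ?_
    by_cases hi : i ∈ A <;> simp [hi, mul_comm]
  rw [hFx, hGx]
  linear_combination (-(F x * G x)) * hl

lemma expect_prod_of_dependsOn {ι : Type*} (q p : ℝ) (s : Finset ι) (A : ι → Finset (Fin n))
    (F : ι → (Fin n → Fin 3) → ℝ) (hF : ∀ j ∈ s, DependsOn (F j) (A j : Set (Fin n)))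
    (hA : ∀ j ∈ s, ∀ k ∈ s, j ≠ k → Disjoint (A j) (A k)) :
    expect q p (fun x => ∏ j ∈ s, F j x) = ∏ j ∈ s, expect q p (F j) := by
  classical
  induction s using Finset.induction_on with
  | empty => simpa using expect_one q p
  | insert a s ha ih =>
    simp only [prod_insert ha]
    rw [expect_mul_of_dependsOn q p (A a) (hF a (mem_insert_self _ _)), ih]
    · exact fun j hj => hF j (mem_insert_of_mem hj)
    · exact fun j hj k hk => hA j (mem_insert_of_mem hj) k (mem_insert_of_mem hk)
    · intro x y hxy
      refine prod_congr rfl fun j hj => hF j (mem_insert_of_mem hj) fun i hi => hxy i fun hia => ?_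
      have hne : a ≠ j := fun h => ha (h ▸ hj)
      exact disjoint_left.1 (hA a (mem_insert_self _ _) j (mem_insert_of_mem hj) hne)
        (mem_coe.1 hia) (mem_coe.1 hi)

/-- Harris' inequality: under a product measure, decreasing functions are positively correlated. -/
lemma expect_mul_le_of_antitone {q p : ℝ} (hq : 0 < q) (hp : 0 < p) (hqp : q + p ≤ 1)
    {F G : (Fin n → Fin 3) → ℝ} (hF₀ : ∀ x, 0 ≤ F x) (hG₀ : ∀ x, 0 ≤ G x)
    (hF : Antitone F) (hG : Antitone G) :
    expect q p F * expect q p G ≤ expect q p (fun x => F x * G x) := by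
  have h := fkg (α := (Fin n → Fin 3)ᵒᵈ) (μ := fun x => law q p (OrderDual.ofDual x))
    (f := fun x => F (OrderDual.ofDual x)) (g := fun x => G (OrderDual.ofDual x))
    (fun x => law_nonneg hq hp hqp _) (fun x => hF₀ _) (fun x => hG₀ _)
    (fun x y hxy => hF hxy) (fun x y hxy => hG hxy) (fun a b => by
      refine le_of_eq ?_
      simp only [law, ← prod_mul_distrib]
      refine prod_congr rfl fun i _ => ?_
      rcases le_total (OrderDual.ofDual a i) (OrderDual.ofDual b i) with hi | hi <;>
        simp [hi, mul_comm])
  have h1 : ∑ x : (Fin n → Fin 3)ᵒᵈ, law q p (OrderDual.ofDual x) = 1 := by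
    have := expect_one (n := n) q p
    simp only [expect, mul_one] at this
    exact this
  rw [h1, one_mul] at h
  exact h

lemma expect_mul_le_of_monotone {q p : ℝ} (hq : 0 < q) (hp : 0 < p) (hqp : q + p ≤ 1)
    {F G : (Fin n → Fin 3) → ℝ} (hF₀ : ∀ x, 0 ≤ F x) (hG₀ : ∀ x, 0 ≤ G x)
    (hF : Monotone F) (hG : Monotone G) :
    expect q p F * expect q p G ≤ expect q p (fun x => F x * G x) := by
  have h := fkg (μ := law (n := n) q p) (f := F) (g := G)
    (fun x => law_nonneg hq hp hqp _) (fun x => hF₀ _) (fun x => hG₀ _) hF hG (fun a b => by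
      refine le_of_eq ?_
      simp only [law, ← prod_mul_distrib]
      refine prod_congr rfl fun i _ => ?_
      rcases le_total (a i) (b i) with hi | hi <;> simp [hi, mul_comm])
  have h1 : ∑ x : Fin n → Fin 3, law q p x = 1 := by
    simpa [expect] using expect_one (n := n) q p
  rwa [h1, one_mul] at h

lemma prod_expect_le_of_antitone {ι : Type*} {q p : ℝ} (hq : 0 < q) (hp : 0 < p)
    (hqp : q + p ≤ 1) (s : Finset ι) (F : ι → (Fin n → Fin 3) → ℝ) (hF₀ : ∀ j x, 0 ≤ F j x)
    (hF : ∀ j, Antitone (F j)) :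
    ∏ j ∈ s, expect q p (F j) ≤ expect q p (fun x => ∏ j ∈ s, F j x) := by
  classical
  induction s using Finset.induction_on with
  | empty => simpa using (expect_one q p).ge
  | insert a s ha ih =>
    simp only [prod_insert ha]
    have h0 : 0 ≤ expect q p (F a) :=
      sum_nonneg fun x _ => mul_nonneg (law_nonneg hq hp hqp x) (hF₀ a x)
    refine (mul_le_mul_of_nonneg_left ih h0).trans ?_
    exact expect_mul_le_of_antitone hq hp hqp (hF₀ a) (fun x => prod_nonneg fun j _ => hF₀ j x)
      (hF a) fun x y hxy => prod_le_prod (fun j _ => hF₀ j y) fun j _ => hF j hxy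

/-! ### The probability of being passed an opportunity -/

/-- The conditional probability, given `x`, that `j` passes an opportunity to a needy neighbour
whose competitors are the needy members of `T`.  The recipient itself is not a member of `T`, so
that this quantity does not depend on the recipient's own coordinate of `x`. -/
noncomputable def passTo (j : Fin n) (T : Finset (Fin n)) (x : Fin n → Fin 3) : ℝ :=
  if x j = 2 then 1 / (1 + ((T.filter fun s => x s = 0).card : ℝ)) else 0

/-- The probability that a needy individual is passed an opportunity by a given neighbour of
degree `d`.  At `d = 0` the division by zero makes it `0`. -/
noncomputable def hitProb (q p : ℝ) (d : ℕ) : ℝ := p / q * ((1 - (1 - q) ^ d) / (d : ℝ))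

lemma objective_eq (q p : ℝ) (d : ℕ) : objective q p d = 1 - q * (1 - hitProb q p d) ^ d := rfl

lemma passTo_nonneg (j : Fin n) (T : Finset (Fin n)) (x : Fin n → Fin 3) : 0 ≤ passTo j T x := by
  unfold passTo
  split_ifs <;> positivity

lemma passTo_le_one (j : Fin n) (T : Finset (Fin n)) (x : Fin n → Fin 3) : passTo j T x ≤ 1 := by
  unfold passTo
  split_ifs
  · rw [div_le_one (by positivity)]
    linarith [Nat.cast_nonneg (α := ℝ) (T.filter fun s => x s = 0).card]
  · exact zero_le_one

lemma passTo_monotone (j : Fin n) (T : Finset (Fin n)) : Monotone (passTo j T) := by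
  intro x y hxy
  by_cases hx : x j = 2
  · have hy : y j = 2 := by
      have : x j ≤ y j := hxy j
      omega
    have hsub : (T.filter fun s => y s = 0) ⊆ T.filter fun s => x s = 0 := fun s hs => by
      simp only [mem_filter] at hs ⊢
      have : x s ≤ y s := hxy s
      exact ⟨hs.1, by omega⟩
    simp only [passTo, hx, hy, if_true]
    have : ((T.filter fun s => y s = 0).card : ℝ) ≤ (T.filter fun s => x s = 0).card := by
      exact_mod_cast card_le_card hsub
    gcongr
  · simpa [passTo, hx] using passTo_nonneg j T y

lemma passTo_dependsOn (j : Fin n) (T : Finset (Fin n)) :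
    DependsOn (passTo j T) (insert j T : Finset (Fin n)) := by
  intro x y hxy
  have hj : x j = y j := hxy j (by simp)
  have hT : (T.filter fun s => x s = 0) = T.filter fun s => y s = 0 :=
    filter_congr fun s hs => by rw [hxy s (by simp [hs])]
  simp only [passTo, hj, hT]

/-- If `T` consists of the competitors of `i`, then by symmetry all members of `insert i T` have
the same chance of receiving from `j`, and these chances add up to the probability that `j` has two
opportunities and `insert i T` has a needy member. -/
lemma expect_passTo {q p : ℝ} (hq : 0 < q) {i j : Fin n} {T : Finset (Fin n)} (hiT : i ∉ T)
    (hij : i ≠ j) (hjT : j ∉ T) : expect q p (passTo j T) = hitProb q p (T.card + 1) := by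
  set S := insert i T with hS
  have hjS : j ∉ S := by simp [hS, hjT, hij.symm]
  have hcard : S.card = T.card + 1 := card_insert_of_notMem hiT
  let share : Fin n → (Fin n → Fin 3) → ℝ := fun k x =>
    if x j = 2 ∧ x k = 0 then 1 / ((S.filter fun s => x s = 0).card : ℝ) else 0
  have h1 : expect q p (share i) = q * expect q p (passTo j T) := by
    have hind := expect_mul_of_dependsOn q p {i} (F := fun x => if x i = 0 then 1 else 0)
      (G := passTo j T) (fun x y h => by simp [h i (by simp)]) fun x y h =>
        passTo_dependsOn j T fun k hk => h k (by
          rintro hki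
          have hki : k = i := by simpa using hki
          subst hki
          simp [hij, hiT] at hk)
    have hc := expect_coord q p i fun k => if k = 0 then 1 else 0
    simp only [mul_ite, mul_one, mul_zero, sum_ite_eq', mem_univ, if_true] at hc
    rw [hc, show opportunityProb q p 0 = q by simp [opportunityProb]] at hind
    rw [← hind]
    refine congrArg _ (funext fun x => ?_)
    by_cases hi : x i = 0
    · by_cases hj : x j = 2
      · simp [share, passTo, hi, hj, hS, filter_insert, hiT, add_comm]
      · simp [share, passTo, hj]
    · simp [share, hi]
  have h2 : ∀ k ∈ S, expect q p (share k) = expect q p (share i) := by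
    intro k hk
    rw [← expect_comp_perm q p (Equiv.swap i k) (share i)]
    refine congrArg _ (funext fun x => ?_)
    have hkj : j ≠ k := fun h => hjS (h ▸ hk)
    have hc : (S.filter fun s => (x ∘ Equiv.swap i k) s = 0).card =
        (S.filter fun s => x s = 0).card := by
      have hmem : ∀ s, Equiv.swap i k s ∈ S ↔ s ∈ S := fun s => by
        have hi : i ∈ S := mem_insert_self _ _
        rcases eq_or_ne s i with rfl | h1
        · simp [hk, hi]
        · rcases eq_or_ne s k with rfl | h2
          · simp [hk, hi]
          · rw [Equiv.swap_apply_of_ne_of_ne h1 h2]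
      refine card_equiv (Equiv.swap i k) fun s => ?_
      simp [hmem]
    simp only [share, hc]
    simp [Equiv.swap_apply_of_ne_of_ne hij.symm hkj]
  -- The subtracted product is the indicator of `x j = 2` together with no member of `S` being needy.
  have h3 : ∀ x, ∑ k ∈ S, share k x = (if x j = 2 then 1 else 0) -
      ∏ l, (if l = j then (if x l = 2 then 1 else 0) else
        if l ∈ S then (if x l = 0 then 0 else 1) else 1 : ℝ) := by
    intro x
    by_cases hj : x j = 2
    · rcases (S.filter fun s => x s = 0).eq_empty_or_nonempty with he | hne
      · have he' : ∀ s ∈ S, x s ≠ 0 := fun s hs h0 => by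
          have : s ∈ S.filter fun s => x s = 0 := mem_filter.2 ⟨hs, h0⟩
          simp [he] at this
        rw [sum_eq_zero fun k hk => by simp [share, he' k hk], prod_eq_one fun l _ => ?_]
        · simp [hj]
        · rcases eq_or_ne l j with rfl | hl
          · simp [hj]
          · by_cases hlS : l ∈ S
            · simp [hl, hlS, he' l hlS]
            · simp [hl, hlS]
      · obtain ⟨s, hs⟩ := id hne
        rw [mem_filter] at hs
        have hsj : s ≠ j := fun h => hjS (h ▸ hs.1)
        rw [prod_eq_zero (mem_univ s) (by simp [hsj, hs.1, hs.2])]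
        simp only [share, hj, true_and, if_true, sub_zero]
        rw [← sum_filter, sum_const, nsmul_eq_mul, mul_one_div_cancel]
        exact_mod_cast hne.card_pos.ne'
    · rw [prod_eq_zero (mem_univ j) (by simp [hj])]
      simp [share, hj]
  have h4 := expect_sum q p S share
  rw [sum_congr rfl h2, sum_const, nsmul_eq_mul, hcard, h1] at h4
  simp only [h3] at h4
  rw [expect_sub, expect_coord q p j fun k => if k = 2 then (1 : ℝ) else 0,
    expect_prod_coord q p fun l k => if l = j then (if k = 2 then 1 else 0) else
        if l ∈ S then (if k = 0 then 0 else 1) else 1] at h4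
  have h5 : ∏ l, ∑ k, opportunityProb q p k * (if l = j then (if k = 2 then 1 else 0) else
        if l ∈ S then (if k = 0 then 0 else 1) else 1) = p * (1 - q) ^ (T.card + 1) := by
    rw [← mul_prod_erase univ _ (mem_univ j)]
    congr 1
    · simp [opportunityProb]
    · rw [← hcard, ← prod_const, ← prod_subset (s₁ := S)]
      · refine prod_congr rfl fun l hl => ?_
        have : l ≠ j := fun h => hjS (h ▸ hl)
        simp only [this, hl, if_true, if_false, Fin.sum_univ_three]
        simp [opportunityProb]
        ring
      · exact fun l hl => mem_erase.2 ⟨fun h => hjS (h ▸ hl), mem_univ l⟩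
      · intro l hl hlS
        simp [(mem_erase.1 hl).1, hlS, sum_opportunityProb]
  rw [h5] at h4
  have h6 : ∑ k, opportunityProb q p k * (if k = 2 then 1 else 0) = p := by
    simp [opportunityProb]
  rw [h6] at h4
  unfold hitProb
  push_cast at h4 ⊢
  have : (0 : ℝ) < (T.card : ℝ) + 1 := by positivity
  field_simp
  linarith

lemma hitProb_one {q p : ℝ} (hq : 0 < q) : hitProb q p 1 = p := by
  simp [hitProb, hq.ne']

/-- In fact `hitProb q p d ≤ p`, by Bernoulli's inequality. -/
lemma hitProb_lt_one {q p : ℝ} (hq : 0 < q) (hp : 0 < p) (hqp : q + p ≤ 1) (d : ℕ) :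
    hitProb q p d < 1 := by
  rcases Nat.eq_zero_or_pos d with rfl | hd
  · simp [hitProb]
  · have hd' : (0 : ℝ) < d := by exact_mod_cast hd
    have hb := one_add_mul_le_pow (show (-2 : ℝ) ≤ -q by linarith) d
    have h1 : (1 - (1 - q) ^ d) / (d : ℝ) ≤ q := by
      rw [div_le_iff₀ hd', sub_eq_add_neg (1 : ℝ) q]
      linarith
    calc hitProb q p d ≤ p / q * q := by unfold hitProb; gcongr
      _ = p := by field_simp
      _ < 1 := by linarith

/-- Two neighbours who compete for passing to the same individual and also for each other:
the positive correlation is strict.  Both pass only if neither of them is needy, so dropping them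
from each other's competitors does not change the product; but it raises both expectations. -/
lemma expect_passTo_mul_lt {q p : ℝ} (hq : 0 < q) (hp : 0 < p) (hqp : q + p ≤ 1) {j k : Fin n}
    {T U : Finset (Fin n)} (hjk : j ≠ k) (hkT : k ∈ T) (hjU : j ∈ U) :
    expect q p (passTo j T) * expect q p (passTo k U) <
      expect q p (fun x => passTo j T x * passTo k U x) := by
  -- Dropping `b` matters on the event that `a` has two opportunities and everyone else is needy.
  have key : ∀ (a b : Fin n) (V : Finset (Fin n)), a ≠ b → b ∈ V →
      expect q p (passTo a V) < expect q p (passTo a (V.erase b)) := by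
    intro a b V hab hb
    refine expect_lt hq hp hqp (fun x => ?_) (fun i => if i = a then 2 else 0) (fun i => ?_) ?_
    · unfold passTo
      have : (((V.erase b).filter fun s => x s = 0).card : ℝ) ≤
          (V.filter fun s => x s = 0).card := by
        exact_mod_cast card_le_card (filter_subset_filter _ (erase_subset _ _))
      split_ifs
      · gcongr
      · exact le_rfl
    · split_ifs <;> decide
    · have hlt : (((V.erase b).filter fun s => (if s = a then (2 : Fin 3) else 0) = 0).card : ℝ) <
          (V.filter fun s => (if s = a then (2 : Fin 3) else 0) = 0).card := by
        rw [filter_erase]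
        exact_mod_cast card_lt_card (erase_ssubset (mem_filter.2 ⟨hb, by simp [hab.symm]⟩))
      simp only [passTo, if_true]
      gcongr
  have hprod : ∀ x : Fin n → Fin 3,
      passTo j (T.erase k) x * passTo k (U.erase j) x = passTo j T x * passTo k U x := by
    intro x
    by_cases hj : x j = 2
    · by_cases hk : x k = 2
      · have h0 : ∀ (V : Finset (Fin n)) (b : Fin n), x b = 2 →
            ((V.erase b).filter fun s => x s = 0) = V.filter fun s => x s = 0 := by
          intro V b hb
          rw [filter_erase, erase_eq_of_notMem]
          simp [hb]
        simp only [passTo, h0 T k hk, h0 U j hj]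
      · simp [passTo, hk]
    · simp [passTo, hj]
  have hnonneg : ∀ (a : Fin n) (V : Finset (Fin n)), 0 ≤ expect q p (passTo a V) := fun a V =>
    sum_nonneg fun x _ => mul_nonneg (law_nonneg hq hp hqp x) (passTo_nonneg a V x)
  calc expect q p (passTo j T) * expect q p (passTo k U)
      < expect q p (passTo j (T.erase k)) * expect q p (passTo k (U.erase j)) :=
        mul_lt_mul'' (key j k T hjk hkT) (key k j U hjk.symm hjU) (hnonneg _ _) (hnonneg _ _)
    _ ≤ expect q p (fun x => passTo j (T.erase k) x * passTo k (U.erase j) x) :=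
        expect_mul_le_of_monotone hq hp hqp (passTo_nonneg _ _) (passTo_nonneg _ _)
          (passTo_monotone _ _) (passTo_monotone _ _)
    _ = _ := by simp only [hprod]

/-! ### Expected utilities -/

lemma mem_nbrs {E : SimpleGraph (Fin n)} {i j : Fin n} : j ∈ nbrs E i ↔ E.Adj i j := by
  simp [nbrs]

/-- The probability that a needy `i` is passed nothing in the network `E`. -/
noncomputable def missProb (E : SimpleGraph (Fin n)) (q p : ℝ) (i : Fin n) : ℝ :=
  expect q p fun x => ∏ j ∈ nbrs E i, (1 - passTo j ((nbrs E j).erase i) x)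

lemma sum_passProb (E : SimpleGraph (Fin n)) (x : Fin n → Fin 3) (j : Fin n) :
    ∑ o, passProb E x j o = 1 := by
  rw [Fintype.sum_option]
  by_cases h : x j = 2 ∧ (needy E x j).Nonempty
  · have hc : ((needy E x j).card : ℝ) ≠ 0 := by exact_mod_cast h.2.card_pos.ne'
    simp [passProb, h.1, h.2, hc]
  · have : ∀ i, passProb E x j (some i) = 0 := fun i => by
      simp only [passProb]
      exact if_neg fun h' => h ⟨h'.1, i, h'.2⟩
    rw [sum_eq_zero fun i _ => this i]
    simp [passProb, h]

lemma passProb_some {E : SimpleGraph (Fin n)} {x : Fin n → Fin 3} {i j : Fin n} (hi : x i = 0)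
    (hj : j ∈ nbrs E i) : passProb E x j (some i) = passTo j ((nbrs E j).erase i) x := by
  have hij : i ∈ nbrs E j := mem_nbrs.2 (mem_nbrs.1 hj).symm
  have hmem : i ∈ needy E x j := mem_filter.2 ⟨hij, hi⟩
  have hcard : ((needy E x j).card : ℝ) =
      1 + ((((nbrs E j).erase i).filter fun s => x s = 0).card : ℝ) := by
    rw [filter_erase, ← card_erase_add_one hmem]
    push_cast
    exact add_comm _ _
  simp only [passProb, passTo, hmem, and_true, hcard]

/-- Given the exogenous opportunities, the recipients are independent, so that the conditional
probability of being passed nothing is a product over the neighbours. -/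
lemma sum_prod_passProb_mul_payoff (E : SimpleGraph (Fin n)) (x : Fin n → Fin 3) (i : Fin n) :
    ∑ t : Fin n → Option (Fin n), (∏ j, passProb E x j (t j)) * payoff E 0 x t i =
      1 - (if x i = 0 then 1 else 0) *
        ∏ j ∈ nbrs E i, (1 - passTo j ((nbrs E j).erase i) x) := by
  have htot : ∑ t : Fin n → Option (Fin n), ∏ j, passProb E x j (t j) = 1 := by
    rw [← Fintype.prod_sum]
    exact prod_eq_one fun j _ => sum_passProb E x j
  by_cases hi : x i = 0
  · have hpay : ∀ t : Fin n → Option (Fin n), payoff E 0 x t i =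
        1 - ∏ j, (if j ∈ nbrs E i then (if t j = some i then 0 else 1) else 1 : ℝ) := by
      intro t
      have hnn : ∀ j ∈ nbrs E i, (0 : ℝ) ≤ if t j = some i then 1 else 0 := fun j _ => by
        split_ifs <;> norm_num
      simp only [payoff, hi, zero_mul, sub_zero]
      by_cases h : ∃ j ∈ nbrs E i, t j = some i
      · obtain ⟨j, hj, hjt⟩ := h
        have h1 := single_le_sum hnn hj
        simp only [hjt, if_true] at h1
        rw [prod_eq_zero (mem_univ j) (by simp [hj, hjt]), min_eq_left]
        · simp
        · simpa using h1
      · push Not at h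
        rw [sum_eq_zero fun j hj => by simp [h j hj], prod_eq_one fun j _ => ?_]
        · simp
        · by_cases hj : j ∈ nbrs E i
          · simp [hj, h j hj]
          · simp [hj]
    have hmiss : ∑ t : Fin n → Option (Fin n), (∏ j, passProb E x j (t j)) *
        ∏ j, (if j ∈ nbrs E i then (if t j = some i then 0 else 1) else 1 : ℝ) =
          ∏ j ∈ nbrs E i, (1 - passTo j ((nbrs E j).erase i) x) := by
      simp only [← prod_mul_distrib]
      rw [← Fintype.prod_sum fun j o =>
        passProb E x j o * (if j ∈ nbrs E i then (if o = some i then 0 else 1) else 1 : ℝ)]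
      rw [← prod_subset (subset_univ (nbrs E i))]
      · refine prod_congr rfl fun j hj => ?_
        have h1 := sum_erase_eq_sub (f := passProb E x j) (mem_univ (some i))
        rw [sum_passProb] at h1
        rw [← passProb_some hi hj, ← h1, ← sum_erase univ (a := some i) (by simp [hj])]
        exact sum_congr rfl fun o ho => by simp [hj, (mem_erase.1 ho).1]
      · intro j _ hj
        simpa only [hj, if_false, mul_one] using sum_passProb E x j
    simp only [hpay, mul_sub, mul_one, sum_sub_distrib, htot, hmiss, hi, if_true, one_mul]
  · have hpay : ∀ t : Fin n → Option (Fin n), payoff E 0 x t i = 1 := by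
      intro t
      have h1 : (1 : ℝ) ≤ ((x i : ℕ) : ℝ) := by
        have : 1 ≤ (x i : ℕ) := by
          have : (x i : ℕ) ≠ 0 := fun h => hi (Fin.ext h)
          omega
        exact_mod_cast this
      have h2 : (0 : ℝ) ≤ ∑ j ∈ nbrs E i, if t j = some i then (1 : ℝ) else 0 :=
        sum_nonneg fun j _ => by split_ifs <;> norm_num
      simp only [payoff, zero_mul, sub_zero]
      exact min_eq_left (by linarith)
    simp [hpay, htot, hi]

lemma utility_eq (E : SimpleGraph (Fin n)) (q p : ℝ) (i : Fin n) :
    utility E q p 0 i = 1 - q * missProb E q p i := by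
  have h1 : utility E q p 0 i = expect q p fun x => 1 - (if x i = 0 then 1 else 0) *
      ∏ j ∈ nbrs E i, (1 - passTo j ((nbrs E j).erase i) x) := by
    refine sum_congr rfl fun x _ => ?_
    dsimp only
    rw [← sum_prod_passProb_mul_payoff, mul_sum]
    exact sum_congr rfl fun t _ => by rw [outcomeProb, law, mul_assoc]
  rw [h1, expect_sub, expect_one, expect_mul_of_dependsOn q p {i}]
  · have hc := expect_coord q p i fun k => if k = 0 then 1 else 0
    simp only [mul_ite, mul_one, mul_zero, sum_ite_eq', mem_univ, if_true] at hc
    rw [hc]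
    simp [opportunityProb, missProb]
  · exact fun x y h => by simp [h i (by simp)]
  · intro x y h
    refine prod_congr rfl fun j hj => ?_
    have hij : i ≠ j := (mem_nbrs.1 hj).ne
    rw [passTo_dependsOn j _ fun k hk => h k fun hki => ?_]
    have hki : k = i := by simpa using hki
    subst hki
    simp [hij] at hk

lemma nbrs_card_le (E : SimpleGraph (Fin n)) (i : Fin n) : (nbrs E i).card ≤ n - 1 := by
  have h : nbrs E i ⊆ univ.erase i := fun j hj =>
    mem_erase.2 ⟨(mem_nbrs.1 hj).ne', mem_univ j⟩
  simpa using card_le_card h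

lemma expect_passTo_nbrs {q p : ℝ} (hq : 0 < q) {E : SimpleGraph (Fin n)} {i j : Fin n}
    (hj : j ∈ nbrs E i) :
    expect q p (passTo j ((nbrs E j).erase i)) = hitProb q p (nbrs E j).card := by
  have hadj := mem_nbrs.1 hj
  have hij : i ∈ nbrs E j := mem_nbrs.2 hadj.symm
  rw [expect_passTo hq (notMem_erase i _) hadj.ne (by simp [mem_nbrs]), card_erase_add_one hij]

lemma expect_one_sub_passTo_nbrs {q p : ℝ} (hq : 0 < q) {E : SimpleGraph (Fin n)} {i j : Fin n}
    (hj : j ∈ nbrs E i) :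
    expect q p (fun x => 1 - passTo j ((nbrs E j).erase i) x) =
      1 - hitProb q p (nbrs E j).card := by
  rw [expect_sub, expect_one, expect_passTo_nbrs hq hj]

/-- In any network the events of not being passed an opportunity by the single neighbours are
positively correlated. -/
lemma prod_le_missProb {q p : ℝ} (hq : 0 < q) (hp : 0 < p) (hqp : q + p ≤ 1)
    (E : SimpleGraph (Fin n)) (i : Fin n) :
    ∏ j ∈ nbrs E i, (1 - hitProb q p (nbrs E j).card) ≤ missProb E q p i := by
  rw [← prod_congr rfl fun j hj => expect_one_sub_passTo_nbrs hq hj]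
  exact prod_expect_le_of_antitone hq hp hqp _ _
    (fun j x => sub_nonneg.2 (passTo_le_one _ _ _))
    fun j x y hxy => sub_le_sub_left (passTo_monotone _ _ hxy) 1

/-- Without triangles and 4-cycles, the neighbours of `i` look at disjoint sets of coordinates. -/
lemma missProb_eq_of_cycleFree {q p : ℝ} (hq : 0 < q) {E : SimpleGraph (Fin n)} {d : ℕ}
    (hE : IsCycleFreeRegular E d) (i : Fin n) : missProb E q p i = (1 - hitProb q p d) ^ d := by
  have h3 : ∀ a b c, E.Adj a b → E.Adj b c → E.Adj c a → False := fun a b c hab hbc hca =>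
    (hE.2 a (.cons hab (.cons hbc (.cons hca .nil))) (by
      simp [SimpleGraph.Walk.cons_isCycle_iff, hab.ne', hbc.ne, hca.ne, hab.ne, hca.ne'])).1 rfl
  have h4 : ∀ a b c e, E.Adj a b → E.Adj b c → E.Adj c e → E.Adj e a → a ≠ c → b ≠ e → False :=
    fun a b c e hab hbc hce hea hac hbe =>
    (hE.2 a (.cons hab (.cons hbc (.cons hce (.cons hea .nil)))) (by
      simp [SimpleGraph.Walk.cons_isCycle_iff, hab.ne', hbc.ne, hce.ne, hea.ne, hab.ne,
        hea.ne', hac, hac.symm, hbe])).2 rfl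
  have hdeg : ∏ j ∈ nbrs E i, (1 - hitProb q p (nbrs E j).card) = (1 - hitProb q p d) ^ d := by
    simp [hE.1]
  rw [missProb, ← hdeg, expect_prod_of_dependsOn q p _
    (fun j => insert j ((nbrs E j).erase i)) _ (fun j _ x y h => by rw [passTo_dependsOn j _ h])]
  · exact prod_congr rfl fun j hj => expect_one_sub_passTo_nbrs hq hj
  · intro j hj k hk hjk
    rw [mem_nbrs] at hj hk
    rw [disjoint_left]
    intro l hl hl'
    simp only [mem_insert, mem_erase, mem_nbrs] at hl hl'
    rcases hl with rfl | ⟨hli, hjl⟩ <;> rcases hl' with h | ⟨-, hkl⟩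
    · exact hjk h
    · exact h3 i k l hk hkl hj.symm
    · subst h
      exact h3 i j l hj hjl hk.symm
    · exact h4 i j l k hj hjl hkl.symm hk.symm (Ne.symm hli) hjk

/-- A triangle at `i` makes the positive correlation strict. -/
lemma prod_lt_missProb_of_triangle {q p : ℝ} (hq : 0 < q) (hp : 0 < p) (hqp : q + p ≤ 1)
    {E : SimpleGraph (Fin n)} {i j k : Fin n} (hij : E.Adj i j) (hjk : E.Adj j k)
    (hki : E.Adj k i) :
    ∏ l ∈ nbrs E i, (1 - hitProb q p (nbrs E l).card) < missProb E q p i := by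
  set F : Fin n → (Fin n → Fin 3) → ℝ := fun l x => 1 - passTo l ((nbrs E l).erase i) x with hF
  have hF₀ : ∀ l x, 0 ≤ F l x := fun l x => sub_nonneg.2 (passTo_le_one _ _ _)
  have hFa : ∀ l, Antitone (F l) := fun l x y hxy => sub_le_sub_left (passTo_monotone _ _ hxy) 1
  have hj : j ∈ nbrs E i := mem_nbrs.2 hij
  have hk : k ∈ (nbrs E i).erase j := mem_erase.2 ⟨hjk.ne', mem_nbrs.2 hki.symm⟩
  set s := ((nbrs E i).erase j).erase k with hs
  have hsplit : ∀ f : Fin n → ℝ, ∏ l ∈ nbrs E i, f l = f j * f k * ∏ l ∈ s, f l := fun f => by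
    rw [← mul_prod_erase _ f hj, ← mul_prod_erase _ f hk, mul_assoc]
  have hpair : expect q p (F j) * expect q p (F k) < expect q p (fun x => F j x * F k x) := by
    have h := expect_passTo_mul_lt hq hp hqp (T := (nbrs E j).erase i) (U := (nbrs E k).erase i)
      hjk.ne (mem_erase.2 ⟨hki.ne, mem_nbrs.2 hjk⟩) (mem_erase.2 ⟨hij.ne', mem_nbrs.2 hjk.symm⟩)
    have hexp : (fun x => F j x * F k x) = fun x => (1 - passTo j ((nbrs E j).erase i) x) -
        (passTo k ((nbrs E k).erase i) x -
          passTo j ((nbrs E j).erase i) x * passTo k ((nbrs E k).erase i) x) := by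
      funext x
      simp only [hF]
      ring
    rw [hexp, expect_sub, expect_sub, expect_sub, expect_sub, expect_sub, expect_one]
    linarith
  have hpos : 0 < ∏ l ∈ s, (1 - hitProb q p (nbrs E l).card) :=
    prod_pos fun l _ => sub_pos.2 (hitProb_lt_one hq hp hqp _)
  have hrest : ∏ l ∈ s, (1 - hitProb q p (nbrs E l).card) ≤ expect q p fun x => ∏ l ∈ s, F l x := by
    rw [← prod_congr rfl fun l hl => expect_one_sub_passTo_nbrs hq
      (mem_of_mem_erase (mem_of_mem_erase hl))]
    exact prod_expect_le_of_antitone hq hp hqp _ _ hF₀ hFa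
  rw [hsplit, ← expect_one_sub_passTo_nbrs hq hj,
    ← expect_one_sub_passTo_nbrs hq (mem_of_mem_erase hk)]
  calc _ < expect q p (fun x => F j x * F k x) * ∏ l ∈ s, (1 - hitProb q p (nbrs E l).card) :=
        mul_lt_mul_of_pos_right hpair hpos
    _ ≤ expect q p (fun x => F j x * F k x) * expect q p (fun x => ∏ l ∈ s, F l x) :=
        mul_le_mul_of_nonneg_left hrest (sum_nonneg fun x _ =>
          mul_nonneg (law_nonneg hq hp hqp x) (mul_nonneg (hF₀ j x) (hF₀ k x)))
    _ ≤ expect q p (fun x => F j x * F k x * ∏ l ∈ s, F l x) :=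
        expect_mul_le_of_antitone hq hp hqp (fun x => mul_nonneg (hF₀ j x) (hF₀ k x))
          (fun x => prod_nonneg fun l _ => hF₀ l x)
          (fun x y hxy => mul_le_mul (hFa j hxy) (hFa k hxy) (hF₀ k y) (hF₀ j x))
          fun x y hxy => prod_le_prod (fun l _ => hF₀ l y) fun l _ => hFa l hxy
    _ = missProb E q p i := by
        rw [missProb]
        refine congrArg _ (funext fun x => ?_)
        rw [hsplit]

/-! ### Equilibria -/

/-- A new link strictly benefits both its ends: it leaves the competitors at the old neighbours
unchanged, and with positive probability everyone is needy except for the new neighbour, who has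
two opportunities. -/
lemma utility_lt_of_add_edge {q p : ℝ} (hq : 0 < q) (hp : 0 < p) (hqp : q + p ≤ 1)
    {E E' : SimpleGraph (Fin n)} {i j : Fin n} (hij : i ≠ j) (hnot : ¬ E.Adj i j)
    (hE : ∀ a b, E'.Adj a b ↔ E.Adj a b ∨ (a = i ∧ b = j) ∨ (a = j ∧ b = i)) :
    utility E q p 0 i < utility E' q p 0 i := by
  have hj : j ∉ nbrs E i := fun h => hnot (mem_nbrs.1 h)
  have hN : nbrs E' i = insert j (nbrs E i) := by
    ext k
    simp only [mem_nbrs, mem_insert, hE]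
    grind
  have hNk : ∀ k ∈ nbrs E i, (nbrs E' k).erase i = (nbrs E k).erase i := by
    intro k hk
    have hkj : k ≠ j := fun h => hj (h ▸ hk)
    have hki : k ≠ i := (mem_nbrs.1 hk).ne'
    ext l
    simp only [mem_nbrs, mem_erase, hE]
    grind
  have hprod : ∀ x, ∏ k ∈ nbrs E' i, (1 - passTo k ((nbrs E' k).erase i) x) =
      (1 - passTo j ((nbrs E' j).erase i) x) *
        ∏ k ∈ nbrs E i, (1 - passTo k ((nbrs E k).erase i) x) := fun x => by
    rw [hN, prod_insert hj]
    congr 1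
    exact prod_congr rfl fun k hk => by rw [hNk k hk]
  rw [utility_eq, utility_eq]
  refine sub_lt_sub_left (mul_lt_mul_of_pos_left ?_ hq) 1
  refine expect_lt hq hp hqp (fun x => ?_) (fun k => if k = j then 2 else 0) (fun k => ?_) ?_
  · rw [hprod]
    refine mul_le_of_le_one_left (prod_nonneg fun k _ => sub_nonneg.2 (passTo_le_one _ _ _)) ?_
    linarith [passTo_nonneg j ((nbrs E' j).erase i) x]
  · split_ifs <;> decide
  · rw [hprod]
    refine mul_lt_of_lt_one_left (prod_pos fun k hk => ?_) ?_
    · have hkj : k ≠ j := fun h => hj (h ▸ hk)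
      simp [passTo, hkj]
    · simp only [passTo, if_true, sub_lt_self_iff]
      positivity

lemma isEquilibrium_iff {q p : ℝ} (hq : 0 < q) (hp : 0 < p) (hqp : q + p ≤ 1)
    (E : SimpleGraph (Fin n)) : IsEquilibrium E q p 0 ↔ E = ⊤ := by
  constructor
  · intro h
    ext i j
    simp only [SimpleGraph.top_adj]
    refine ⟨fun h => h.ne, fun hij => by_contra fun hnot => ?_⟩
    have key : ∀ a b : Fin n, a ≠ b → ¬ E.Adj a b →
        utility E q p 0 a < utility (addAndDrop E a b ∅) q p 0 a := fun a b hab hnot =>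
      utility_lt_of_add_edge hq hp hqp hab hnot fun c e => by
        simp only [addAndDrop, SimpleGraph.deleteEdges_adj, SimpleGraph.sup_adj,
          SimpleGraph.fromEdgeSet_adj, Set.mem_singleton_iff, Sym2.eq_iff]
        simp
        grind
    rcases h.1 i j hij hnot ∅ (empty_subset _) ∅ (empty_subset _) with h | h
    · linarith [key i j hij hnot]
    · linarith [key j i hij.symm fun h => hnot h.symm]
  · rintro rfl
    refine ⟨fun i j hij hnot => absurd hij hnot, fun i j hij => ?_⟩
    have hne : i ≠ j := hij
    have key : ∀ a b : Fin n, a ≠ b → s(a, b) = s(i, j) →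
        utility ((⊤ : SimpleGraph (Fin n)).deleteEdges {s(i, j)}) q p 0 a <
          utility ⊤ q p 0 a := fun a b hab he => by
      rw [← he]
      exact utility_lt_of_add_edge hq hp hqp hab (by simp) fun c e => by
        simp only [SimpleGraph.deleteEdges_adj, SimpleGraph.top_adj, Set.mem_singleton_iff,
          Sym2.eq_iff]
        grind
    constructor
    · linarith [key i j hne rfl]
    · linarith [key j i hne.symm Sym2.eq_swap]

/-! ### Efficient networks -/

/-- The inequality of arithmetic and geometric means, in the form `log y ≤ y - 1`, with its
equality case. -/
lemma card_mul_le_sum_of_pow_le_prod {P : Fin n → ℝ} {m : ℝ} (hm : 0 < m) (hP : ∀ i, 0 < P i)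
    (hprod : m ^ n ≤ ∏ i, P i) :
    n * m ≤ ∑ i, P i ∧ (∑ i, P i ≤ n * m → ∀ i, P i = m) := by
  have hy : ∀ i, 0 < P i / m := fun i => div_pos (hP i) hm
  have hlog : 0 ≤ ∑ i, Real.log (P i / m) := by
    rw [← Real.log_prod fun i _ => (hy i).ne']
    refine Real.log_nonneg ?_
    rw [prod_div_distrib, prod_const, card_univ, Fintype.card_fin, one_le_div (pow_pos hm n)]
    exact hprod
  have hsum : ∑ i, P i = m * ∑ i, (P i / m - 1) + n * m := by
    simp only [sum_sub_distrib, ← sum_div, sum_const, card_univ, Fintype.card_fin, nsmul_eq_mul]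
    field_simp
    ring
  have hle : ∀ i ∈ univ, Real.log (P i / m) ≤ P i / m - 1 := fun i _ =>
    Real.log_le_sub_one_of_pos (hy i)
  have h0 := hlog.trans (sum_le_sum hle)
  refine ⟨by nlinarith [mul_nonneg hm.le h0], fun h i => by_contra fun hne => ?_⟩
  have hlt := hlog.trans_lt (sum_lt_sum hle ⟨i, mem_univ i, Real.log_lt_sub_one_of_pos (hy i)
    fun h1 => hne ((div_eq_one_iff_eq hm.ne').1 h1)⟩)
  linarith [mul_pos hm hlt]

/-- Regrouping the product over all links by the other end: everybody contributes to each of its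
neighbours. -/
lemma prod_prod_nbrs (E : SimpleGraph (Fin n)) (a : Fin n → ℝ) :
    ∏ i, ∏ j ∈ nbrs E i, a j = ∏ j, a j ^ (nbrs E j).card := by
  rw [prod_comm' (t' := univ) (s' := fun j => nbrs E j)
    fun i j => by simp [mem_nbrs, E.adj_comm]]
  exact prod_congr rfl fun j _ => prod_const _

lemma IsOptimalDegree.le {q p : ℝ} {d : ℕ} (hq : 0 < q) (hd : IsOptimalDegree n q p d) {k : ℕ}
    (hk : k ≤ n) : (1 - hitProb q p d) ^ d ≤ (1 - hitProb q p k) ^ k := by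
  have h : objective q p k ≤ objective q p d := hd.2 hk
  rw [objective_eq, objective_eq] at h
  exact le_of_mul_le_mul_left (by linarith) hq

lemma sum_prod_nbrs {q p : ℝ} (hq : 0 < q) (hp : 0 < p) (hqp : q + p ≤ 1) {d : ℕ}
    (hd : IsOptimalDegree n q p d) (E : SimpleGraph (Fin n)) :
    n * (1 - hitProb q p d) ^ d ≤ ∑ i, ∏ j ∈ nbrs E i, (1 - hitProb q p (nbrs E j).card) ∧
      (∑ i, ∏ j ∈ nbrs E i, (1 - hitProb q p (nbrs E j).card) ≤ n * (1 - hitProb q p d) ^ d →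
        ∀ i, ∏ j ∈ nbrs E i, (1 - hitProb q p (nbrs E j).card) = (1 - hitProb q p d) ^ d) := by
  have hpos : ∀ k, 0 < 1 - hitProb q p k := fun k => sub_pos.2 (hitProb_lt_one hq hp hqp k)
  refine card_mul_le_sum_of_pow_le_prod (pow_pos (hpos d) d)
    (fun i => prod_pos fun j _ => hpos _) ?_
  rw [prod_prod_nbrs E fun j => 1 - hitProb q p (nbrs E j).card]
  calc ((1 - hitProb q p d) ^ d) ^ n = ∏ _j : Fin n, (1 - hitProb q p d) ^ d := by simp
    _ ≤ _ := prod_le_prod (fun _ _ => (pow_pos (hpos d) d).le) fun j _ =>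
      hd.le hq ((nbrs_card_le E j).trans (Nat.sub_le n 1))

lemma welfare_eq (E : SimpleGraph (Fin n)) (q p : ℝ) :
    welfare E q p 0 = n - q * ∑ i, missProb E q p i := by
  simp [welfare, utility_eq, mul_sum]

lemma isEfficient_of_isCycleFreeRegular {q p : ℝ} (hq : 0 < q) (hp : 0 < p) (hqp : q + p ≤ 1)
    {d : ℕ} (hd : IsOptimalDegree n q p d) {E : SimpleGraph (Fin n)}
    (hE : IsCycleFreeRegular E d) : IsEfficient E q p 0 := by
  intro E'
  rw [welfare_eq, welfare_eq]
  have h1 : ∑ i, missProb E q p i = n * (1 - hitProb q p d) ^ d := by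
    simp [missProb_eq_of_cycleFree hq hE]
  have h2 := (sum_prod_nbrs hq hp hqp hd E').1.trans
    (sum_le_sum fun i _ => prod_le_missProb hq hp hqp E' i)
  rw [h1]
  linarith [mul_le_mul_of_nonneg_left h2 hq.le]

/-- If the upper bound on welfare is attained by some network, then in every efficient network all
individuals have the same expected utility. -/
lemma missProb_eq_of_isEfficient {q p : ℝ} (hq : 0 < q) (hp : 0 < p) (hqp : q + p ≤ 1)
    {d : ℕ} (hd : IsOptimalDegree n q p d) {E₀ E : SimpleGraph (Fin n)}
    (hE₀ : IsCycleFreeRegular E₀ d) (hE : IsEfficient E q p 0) (i : Fin n) :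
    missProb E q p i = (1 - hitProb q p d) ^ d := by
  have h1 : ∑ i, missProb E₀ q p i = n * (1 - hitProb q p d) ^ d := by
    simp [missProb_eq_of_cycleFree hq hE₀]
  have h2 := hE E₀
  rw [welfare_eq, welfare_eq, h1] at h2
  have h3 : ∑ i, missProb E q p i ≤ n * (1 - hitProb q p d) ^ d :=
    le_of_mul_le_mul_left (by linarith) hq
  have hle : ∀ i ∈ univ, ∏ j ∈ nbrs E i, (1 - hitProb q p (nbrs E j).card) ≤ missProb E q p i :=
    fun i _ => prod_le_missProb hq hp hqp E i
  obtain ⟨hlow, heq⟩ := sum_prod_nbrs hq hp hqp hd E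
  rw [← heq ((sum_le_sum hle).trans h3) i]
  exact ((sum_eq_sum_iff_of_le hle).1
    (le_antisymm (sum_le_sum hle) (h3.trans hlow)) i (mem_univ i)).symm

/-- For `n = 1, 2` the degree `n` does strictly better than all smaller ones.  These are the cases
in which the complete network has no triangle. -/
lemma not_isOptimalDegree_of_lt {q p : ℝ} (hq : 0 < q) (hp : 0 < p) (hqp : q + p ≤ 1) {d : ℕ}
    (hn : n ≤ 2) (hdn : d < n) : ¬ IsOptimalDegree n q p d := by
  intro hd
  have hone : (1 - hitProb q p 1) ^ 1 = 1 - p := by rw [hitProb_one hq, pow_one]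
  have htwo : (1 - hitProb q p 2) ^ 2 < 1 - p := by
    have : hitProb q p 2 = p * (2 - q) / 2 := by
      unfold hitProb
      push_cast
      field_simp
      ring
    rw [this]
    -- The difference is `p * ((1 - q) - p * (2 - q) ^ 2 / 4)`, and `p ≤ 1 - q`, `(2 - q) ^ 2 < 4`.
    have h4 : 0 < 4 - (2 - q) ^ 2 := by nlinarith
    nlinarith [mul_pos (mul_pos hp hp) h4, mul_nonneg hp.le (sub_nonneg.2 hqp)]
  interval_cases n <;> interval_cases d
  · have := hd.le hq le_rfl
    rw [hone] at this
    simp only [pow_zero] at this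
    linarith
  · have := hd.le hq le_rfl
    simp only [pow_zero] at this
    linarith
  · have := hd.le hq le_rfl
    linarith

/-- For `n ≤ 2` the hypotheses are contradictory: the degree of `E₀` is below `n`, hence not
optimal. -/
lemma optimal_lt_missProb_top {q p : ℝ} (hq : 0 < q) (hp : 0 < p) (hqp : q + p ≤ 1)
    {d : ℕ} (hd : IsOptimalDegree n q p d) {E₀ : SimpleGraph (Fin n)}
    (hE₀ : IsCycleFreeRegular E₀ d) (i : Fin n) :
    (1 - hitProb q p d) ^ d < missProb ⊤ q p i := by
  rcases Nat.lt_or_ge 2 n with hn | hn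
  · have hcard : ∀ j : Fin n, (nbrs ⊤ j).card = n - 1 := fun j => by
      have : nbrs ⊤ j = univ.erase j := by
        ext k
        simp [mem_nbrs, ne_comm]
      simp [this]
    obtain ⟨j, hj⟩ : ∃ j, j ∉ ({i} : Finset (Fin n)) := by
      by_contra! h
      have := card_le_card (fun k _ => h k : (univ : Finset (Fin n)) ⊆ {i})
      simp at this
      omega
    obtain ⟨k, hk⟩ : ∃ k, k ∉ ({i, j} : Finset (Fin n)) := by
      by_contra! h
      have := (card_le_card (fun k _ => h k : (univ : Finset (Fin n)) ⊆ {i, j})).trans card_le_two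
      simp at this
      omega
    simp only [mem_singleton, mem_insert, not_or] at hj hk
    have h := prod_lt_missProb_of_triangle hq hp hqp (E := ⊤) (i := i) (j := j) (k := k)
      (Ne.symm hj) (Ne.symm hk.2) hk.1
    refine (hd.le hq (Nat.sub_le n 1)).trans_lt (lt_of_eq_of_lt ?_ h)
    simp [hcard]
  · have hdn : d < n := by
      have h1 := nbrs_card_le E₀ i
      have h2 := i.pos
      rw [hE₀.1 i] at h1
      omega
    exact absurd hd (not_isOptimalDegree_of_lt hq hp hqp hn hdn)

end InformedGame

theorem mainTheorem11 (n : ℕ) (q p : ℝ) (hq : 0 < q) (hp : 0 < p) (hqp : q + p ≤ 1) :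
    (∀ (d : ℕ) (E : SimpleGraph (Fin n)), InformedGame.IsOptimalDegree n q p d →
      InformedGame.IsCycleFreeRegular E d → InformedGame.IsEfficient E q p 0) ∧
    (∀ E : SimpleGraph (Fin n), InformedGame.IsEquilibrium E q p 0 ↔ E = ⊤) ∧
    ((∃ (d : ℕ) (E₀ : SimpleGraph (Fin n)), InformedGame.IsOptimalDegree n q p d ∧
        InformedGame.IsCycleFreeRegular E₀ d) →
      ∀ E E' : SimpleGraph (Fin n), InformedGame.IsEfficient E q p 0 →
        InformedGame.IsEquilibrium E' q p 0 →
        ∀ i : Fin n, InformedGame.utility E' q p 0 i < InformedGame.utility E q p 0 i) := by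
  refine ⟨fun d E hd hE =>
      InformedGame.isEfficient_of_isCycleFreeRegular hq hp hqp hd hE,
    InformedGame.isEquilibrium_iff hq hp hqp, ?_⟩
  rintro ⟨d, E₀, hd, hE₀⟩ E E' hE hE' i
  rw [(InformedGame.isEquilibrium_iff hq hp hqp E').1 hE', InformedGame.utility_eq,
    InformedGame.utility_eq, InformedGame.missProb_eq_of_isEfficient hq hp hqp hd hE₀ hE i]
  exact sub_lt_sub_left (mul_lt_mul_of_pos_left
    (InformedGame.optimal_lt_missProb_top hq hp hqp hd hE₀ i) hq) 1
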